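/- **Setting.** In one round of the protocol, $n$ clients are split into $p$ nonempty shards $H_1,\dots,H_p$. Client $i$ has a local update $\Delta_i\in\mathbb{R}^d$ (its locally trained model minus the broadcast global model). An honest client $i\in H_j$ sends the blinded update $g_i=\Delta_i+\sum_{k\in H_j\setminus\{i\}}u_{ik}-\sum_{k\in H_j\setminus\{i\}}u_{ki}$, where $u_{ik}$ is the mask that $i$ sends to $k$; a corrupted client may send arbitrary masks and an arbitrary message $g_i$. At most $\epsilon n$ clients are corrupted. A shard is *benign* if all its clients are honest; its *update* is $X_j=\frac1{|H_j|}\sum_{i\in H_j}\Delta_i$. Let $B$ be the set of benign shards and $\epsilon'=(p-|B|)/p$ the fraction of corrupted shards. The server forms $y_j=\frac1{|H_j|}\sum_{i\in H_j}g_i$ for every shard and outputs $\hat\mu=\text{FilterL2}(y_1,\dots,y_p)$ with variance parameter $\sigma\ge 0$: start with the weights $c_j=1$; while the largest eigenvalue of the weighted covariance of the $y_j$ exceeds $20\sigma^2$, take a unit eigenvector $v$ for it and replace each $c_j$ by $c_j(1-\tau_j/\tau_{\max})$, where $\tau_j=\langle v,y_j-\hat\mu_c\rangle^2$, $\hat\mu_c$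 is the weighted mean and $\tau_{\max}=\max_{c_j\ne0}\tau_j$; finally return $\hat\mu_c$. We say that *the protocol estimates $\mu$ within $e$* if, for every choice of the eigenvectors, FilterL2 stops after at most $p$ iterations and its output satisfies $\|\hat\mu-\mu\|_2\le e$. **Corollary 2 (Robustness against Byzantine adversaries).** There is an absolute constant $C>0$ (independent of $d,n,p,\epsilon,\sigma$ and of everything else) such that, whenever $12\epsilon n<p$, the following hold. 1. $\epsilon'\le\frac{\epsilon n}{p}<\frac1{12}$. If the data set $(X_j)_{j\in B}$ of benign shard updates has mean $\mu$ and covariance $\frac1{|B|}\sum_{j\in B}(X_j-\mu)(X_j-\mu)^{\top}$ of operator norm at most $\sigma^2$, then the protocol estimates $\mu$ within the dimension-free error $C\sigma\sqrt{\epsilon'}\le C\sigma\sqrt{\epsilon n/p}$. 2. Let $\mathcal{D}$ be a probability distribution on $\mathbb{R}^d$ with finite second moment, mean $\mu_{\mathcal D}$ and covariance matrix of operator norm at most $\sigma^2$. For all $\eta,\delta>0$ there is $N=N(\mathcal{D},\sigma,\eta,\delta)$ such that, if $p\ge N$ and the benign shard updates $(X_j)_{j\in B}$ are i.i.d. with law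 $\mathcal{D}$ (for a fixed split into shards and a fixed set of corrupted clients, whose messages and masks may depend arbitrarily on the randomness), then with probability at least $1-\delta$ the protocol estimates $\mu_{\mathcal D}$ within $C\sigma\sqrt{\epsilon'}+\eta$. -/

import Mathlib

open MeasureTheory ProbabilityTheory

noncomputable section

namespace FedLearning

/-- Model parameters and updates: vectors in `ℝ^d` with the Euclidean norm. -/
abbrev Vec (d : ℕ) := EuclideanSpace ℝ (Fin d)

/-! ### Statistics of finite data sets -/

section Statistics

variable {ι : Type*} {d : ℕ}

/-- The mean of the data set `(x j)_{j ∈ s}`. -/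
def dataMean (s : Finset ι) (x : ι → Vec d) : Vec d :=
  (s.card : ℝ)⁻¹ • ∑ j ∈ s, x j

/-- The covariance `|s|⁻¹ ∑_{j ∈ s} (x j - m) (x j - m)ᵀ` of the data set `(x j)_{j ∈ s}`, where
`m` is its mean, as an operator on `ℝ^d`. The norm of a value is the operator norm. -/
def dataCov (s : Finset ι) (x : ι → Vec d) : Vec d →L[ℝ] Vec d :=
  (s.card : ℝ)⁻¹ • ∑ j ∈ s,
    InnerProductSpace.rankOne ℝ (x j - dataMean s x) (x j - dataMean s x)

variable [Fintype ι]

/-- The weighted mean `∑ c i x i / ∑ c i`. -/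
def weightedMean (c : ι → ℝ) (x : ι → Vec d) : Vec d :=
  (∑ i, c i)⁻¹ • ∑ i, c i • x i

/-- The weighted covariance `∑ c i (x i - m) (x i - m)ᵀ / ∑ c i`, with `m` the weighted mean. -/
def weightedCov (c : ι → ℝ) (x : ι → Vec d) : Vec d →L[ℝ] Vec d :=
  (∑ i, c i)⁻¹ • ∑ i, c i •
    InnerProductSpace.rankOne ℝ (x i - weightedMean c x) (x i - weightedMean c x)

/-! ### FilterL2 -/

/-- The squared deviation `τ i = ⟨v, x i - m⟩²` of the point `x i` from the weighted mean `m`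
in the direction `v`. -/
def filterScore (c : ι → ℝ) (x : ι → Vec d) (v : Vec d) (i : ι) : ℝ :=
  (inner ℝ v (x i - weightedMean c x)) ^ 2

/-- `v` is a unit eigenvector for the largest eigenvalue of the positive semidefinite
operator `A` (that eigenvalue equals the operator norm of `A`). -/
def IsTopEigenvector (A : Vec d →L[ℝ] Vec d) (v : Vec d) : Prop :=
  ‖v‖ = 1 ∧ A v = ‖A‖ • v

/-- `FilterReaches η σ x k c`: some run of FilterL2 with input points `x`, variance parameter `σ`
and threshold constant `η` has the weights `c` after `k` iterations.
All weights are `1` at the start. As long as the largest eigenvalue of the weighted covariance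
exceeds `η σ²`, a top unit eigenvector `v` is computed and each weight `c i` is multiplied by
`1 - τ i / M`, where `M` is the largest score `τ i` among the points of nonzero weight. -/
inductive FilterReaches (η σ : ℝ) (x : ι → Vec d) : ℕ → (ι → ℝ) → Prop
  | init : FilterReaches η σ x 0 (fun _ => 1)
  | step {k : ℕ} {c : ι → ℝ} {v : Vec d} {M : ℝ}
      (hc : FilterReaches η σ x k c)
      (hlarge : η * σ ^ 2 < ‖weightedCov c x‖)
      (hv : IsTopEigenvector (weightedCov c x) v)
      (hM : IsGreatest (filterScore c x v '' {i | c i ≠ 0}) M) :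
      FilterReaches η σ x (k + 1) (fun i => c i * (1 - filterScore c x v i / M))

/-- `g` is an output of FilterL2: some run reaches weights `c` for which the largest eigenvalue
of the weighted covariance is at most `η σ²`, and `g` is the weighted mean for these weights. -/
def IsFilterOutput (η σ : ℝ) (x : ι → Vec d) (g : Vec d) : Prop :=
  ∃ (k : ℕ) (c : ι → ℝ), FilterReaches η σ x k c ∧ ‖weightedCov c x‖ ≤ η * σ ^ 2 ∧
    g = weightedMean c x

end Statistics

/-! ### The protocol -/

/-- A split of `n` clients into `p` nonempty shards; `shardOf i` is the shard of client `i`. -/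
structure Sharding (n p : ℕ) where
  shardOf : Fin n → Fin p
  surjective : Function.Surjective shardOf

/-- The data of one round of the protocol. -/
structure Round (n d : ℕ) where
  /-- the global model that the server broadcasts -/
  globalModel : Vec d
  /-- the model that client `i` obtains by honest local training -/
  localModel : Fin n → Vec d
  /-- `mask i k` is the mask that client `i` sends to client `k` (of the same shard) -/
  mask : Fin n → Fin n → Vec d
  /-- the message that client `i` sends to the server -/
  message : Fin n → Vec d

section Protocol

variable {n p d : ℕ}

/-- The clients of shard `j`. -/
def Sharding.members (S : Sharding n p) (j : Fin p) : Finset (Fin n) :=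
  Finset.univ.filter fun i => S.shardOf i = j

/-- The other clients in the shard of client `i`. -/
def Sharding.peers (S : Sharding n p) (i : Fin n) : Finset (Fin n) :=
  (S.members (S.shardOf i)).erase i

/-- The local update of client `i`: its trained model minus the global model. -/
def Round.localUpdate (r : Round n d) (i : Fin n) : Vec d :=
  r.localModel i - r.globalModel

/-- The blinded update that client `i` sends to the server if it follows the protocol: its local
update, plus the masks it generated, minus the masks it received. -/
def Round.blindedUpdate (r : Round n d) (S : Sharding n p) (i : Fin n) : Vec d :=
  r.localUpdate i + ∑ k ∈ S.peers i, r.mask i k - ∑ k ∈ S.peers i, r.mask k i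

/-- The corrupted clients are those in `K`. All other clients follow the protocol; the messages
and masks sent by clients in `K` are arbitrary. -/
def Round.CorruptedWithin (r : Round n d) (S : Sharding n p) (K : Finset (Fin n)) : Prop :=
  ∀ i, i ∉ K → r.message i = r.blindedUpdate S i

/-- What the server computes for shard `j`: the mean of the messages it receives from there. -/
def Round.shardAggregate (r : Round n d) (S : Sharding n p) (j : Fin p) : Vec d :=
  dataMean (S.members j) r.message

/-- The update of shard `j`: the mean of the (unblinded) local updates of its clients. -/
def Round.shardUpdate (r : Round n d) (S : Sharding n p) (j : Fin p) : Vec d :=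
  dataMean (S.members j) r.localUpdate

/-- The shards that contain a corrupted client. -/
def Sharding.corrupted (S : Sharding n p) (K : Finset (Fin n)) : Finset (Fin p) :=
  K.image S.shardOf

/-- The shards all of whose clients are benign. -/
def Sharding.benign (S : Sharding n p) (K : Finset (Fin n)) : Finset (Fin p) :=
  (S.corrupted K)ᶜ

/-- The fraction of corrupted shards. -/
def Sharding.corruptedFraction (S : Sharding n p) (K : Finset (Fin n)) : ℝ :=
  ((S.corrupted K).card : ℝ) / p

/-- `g` is a global update that the server can obtain in the round `r`: an output of FilterL2,
with the threshold constant `20`, on the shard aggregates. -/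
def Round.IsGlobalUpdate (r : Round n d) (S : Sharding n p) (σ : ℝ) (g : Vec d) : Prop :=
  IsFilterOutput 20 σ (r.shardAggregate S) g

/-- In the round `r` the protocol estimates `μ` up to the error `e`: every run of FilterL2 on the
shard aggregates makes at most `p` iterations, there is an output, and every possible output is
within distance `e` of `μ`. -/
def Round.EstimatesWithin (r : Round n d) (S : Sharding n p) (σ : ℝ) (μ : Vec d) (e : ℝ) : Prop :=
  (∀ k c, FilterReaches 20 σ (r.shardAggregate S) k c → k ≤ p) ∧
  (∃ g, r.IsGlobalUpdate S σ g) ∧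
  ∀ g, r.IsGlobalUpdate S σ g → ‖g - μ‖ ≤ e

end Protocol

end FedLearning

end

open FedLearning

noncomputable section

namespace FedLearning

/-! The filter never loses more weight on the benign shards `B` than on the others (`IsSafeWeight`).
Write `b = |Bᶜ| ≤ p/12`. Then `B` loses weight at most `b` and keeps at least `5p/6`. Suppose the
top eigenvalue exceeds `20σ²` and project to its eigenvector. The points of `B` have small spread,
and their first moment about the weighted mean is minus that of the other points, which
Cauchy–Schwarz bounds in terms of `b`. So `B` carries at most half of the weighted score
(`IsSafeWeight.sum_mul_sq_le`), and since the removed weight is proportional to `c j * τ j`, the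
invariant survives. Once the eigenvalue is at most `20σ²`, the same Cauchy–Schwarz bounds put the
mean of `B` within `8σ√(b/p)` of the weighted mean (`IsSafeWeight.sq_mean_le`). Every iteration
annihilates a new weight, hence at most `p` of them.

This bound is deterministic, and masks cancel in benign shards, so corrupted clients may act
arbitrarily. The spread of `B` is allowed to be `2σ²`: for i.i.d. updates, the law of large numbers
for the points and for their rank-one deviation operators gives this with high probability, along
with a sample mean within `η` of the true one. -/

/-! ### Weights of the filter -/

section Weights

variable {ι : Type*} [Fintype ι] [DecidableEq ι]

/-- The weights `c` lie in `[0, 1]`, and at most as much weight has been removed inside `B` as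
outside of `B`. -/
structure IsSafeWeight (B : Finset ι) (c : ι → ℝ) : Prop where
  nonneg : ∀ j, 0 ≤ c j
  le_one : ∀ j, c j ≤ 1
  removed_le : ∑ j ∈ B, (1 - c j) ≤ ∑ j ∈ Bᶜ, (1 - c j)

theorem isSafeWeight_one (B : Finset ι) : IsSafeWeight B fun _ => 1 :=
  ⟨fun _ => zero_le_one, fun _ => le_rfl, by simp⟩

variable {B : Finset ι} {c : ι → ℝ}

theorem IsSafeWeight.sum_compl_le (hc : IsSafeWeight B c) : ∑ j ∈ Bᶜ, c j ≤ (Bᶜ.card : ℝ) := by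
  have := Finset.sum_le_sum fun j (_ : j ∈ Bᶜ) => hc.le_one j
  simpa using this

theorem IsSafeWeight.removed_le_card (hc : IsSafeWeight B c) :
    ∑ j ∈ B, (1 - c j) ≤ (Bᶜ.card : ℝ) := by
  refine hc.removed_le.trans ?_
  have := Finset.sum_le_sum fun j (_ : j ∈ Bᶜ) => sub_le_self (1 : ℝ) (hc.nonneg j)
  simpa using this

theorem card_add_card_compl_real (B : Finset ι) :
    (B.card : ℝ) + Bᶜ.card = Fintype.card ι := by
  exact_mod_cast B.card_add_card_compl

theorem IsSafeWeight.le_sum (hc : IsSafeWeight B c) (hB : 12 * (Bᶜ.card : ℝ) ≤ Fintype.card ι) :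
    5 / 6 * (Fintype.card ι : ℝ) ≤ ∑ j ∈ B, c j := by
  have h := hc.removed_le_card
  rw [Finset.sum_sub_distrib] at h
  simp only [Finset.sum_const, nsmul_eq_mul, mul_one] at h
  linarith [card_add_card_compl_real B]

/-- Cauchy–Schwarz for the first moment outside of `B` of centred points. -/
theorem IsSafeWeight.sq_sum_mul_le (hc : IsSafeWeight B c) {y : ι → ℝ}
    (hy : ∑ j, c j * y j = 0) :
    (∑ j ∈ B, c j * y j) ^ 2 ≤ Bᶜ.card * ∑ j, c j * y j ^ 2 := by
  have h1 : ∑ j ∈ B, c j * y j = -∑ j ∈ Bᶜ, c j * y j := by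
    rw [← Finset.sum_add_sum_compl B] at hy
    linarith
  have h2 : (∑ j ∈ Bᶜ, c j * y j) ^ 2 ≤ (∑ j ∈ Bᶜ, c j) * ∑ j ∈ Bᶜ, c j * y j ^ 2 :=
    Finset.sum_sq_le_sum_mul_sum_of_sq_le_mul _ (fun j _ => hc.nonneg j)
      (fun j _ => mul_nonneg (hc.nonneg j) (sq_nonneg _)) (fun j _ => le_of_eq (by ring))
  have h3 : ∑ j ∈ Bᶜ, c j * y j ^ 2 ≤ ∑ j, c j * y j ^ 2 :=
    Finset.sum_le_sum_of_subset_of_nonneg (Finset.subset_univ _)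
      fun j _ _ => mul_nonneg (hc.nonneg j) (sq_nonneg _)
  rw [h1, neg_sq]
  refine h2.trans (mul_le_mul hc.sum_compl_le h3 ?_ (Nat.cast_nonneg _))
  exact Finset.sum_nonneg fun j _ => mul_nonneg (hc.nonneg j) (sq_nonneg _)

/-- If the weighted second moment is large compared to the spread of the points of `B`, then the
points of `B` contribute at most half of it. -/
theorem IsSafeWeight.sum_mul_sq_le (hc : IsSafeWeight B c)
    (hB : 12 * (Bᶜ.card : ℝ) ≤ Fintype.card ι) (hι : 0 < Fintype.card ι)
    {y : ι → ℝ} {m s l : ℝ} (hy : ∑ j, c j * y j = 0)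
    (hs : ∑ j ∈ B, (y j - m) ^ 2 ≤ 2 * B.card * s) (hsl : 20 * s ≤ l) (hl : 0 ≤ l)
    (hyl : ∑ j, c j * y j ^ 2 = (∑ j, c j) * l) :
    ∑ j ∈ B, c j * y j ^ 2 ≤ (∑ j, c j) * l / 2 := by
  have hp : (0 : ℝ) < Fintype.card ι := by exact_mod_cast hι
  have hW := hc.le_sum hB
  have hWB : ∑ j ∈ B, c j ≤ ∑ j, c j :=
    Finset.sum_le_sum_of_subset_of_nonneg (Finset.subset_univ _) fun j _ _ => hc.nonneg j
  have hz := hc.sq_sum_mul_le hy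
  rw [hyl] at hz
  have hdev : ∑ j ∈ B, c j * (y j - m) ^ 2 ≤ 2 * B.card * s :=
    (Finset.sum_le_sum fun j _ => mul_le_of_le_one_left (sq_nonneg _) (hc.le_one j)).trans hs
  have hexp : ∑ j ∈ B, c j * y j ^ 2 = ∑ j ∈ B, c j * (y j - m) ^ 2
      + 2 * m * ∑ j ∈ B, c j * y j - m ^ 2 * ∑ j ∈ B, c j := by
    rw [Finset.mul_sum, Finset.mul_sum, ← Finset.sum_add_distrib, ← Finset.sum_sub_distrib]
    exact Finset.sum_congr rfl fun j _ => by ring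
  have hBp := card_add_card_compl_real B
  have hb : (0 : ℝ) ≤ Bᶜ.card := Nat.cast_nonneg _
  have hB0 : (0 : ℝ) ≤ B.card := Nat.cast_nonneg _
  rw [hexp]
  generalize ∑ j ∈ B, c j * (y j - m) ^ 2 = V at *
  generalize ∑ j ∈ B, c j * y j = z at *
  generalize ∑ j ∈ B, c j = w at *
  generalize ∑ j, c j = W at *
  generalize (B.card : ℝ) = β at *
  generalize (Bᶜ.card : ℝ) = b at *
  generalize (Fintype.card ι : ℝ) = p at *
  have hw : 0 < w := by linarith
  have hWl : 0 ≤ W * l := mul_nonneg (by linarith) hl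
  -- Completing the square, `w * (2mz - m²w) ≤ z² ≤ b * (W * l)`, and `b ≤ p/12 ≤ w/10`.
  have h1 : 2 * m * z - m ^ 2 * w ≤ W * l / 10 := by
    have h2 : b * (W * l) ≤ w / 10 * (W * l) := mul_le_mul_of_nonneg_right (by linarith) hWl
    have h3 : w * (2 * m * z - m ^ 2 * w) ≤ w * (W * l / 10) := by
      nlinarith [sq_nonneg (z - m * w)]
    exact le_of_mul_le_mul_left h3 hw
  -- `β ≤ p ≤ 6/5 * W`, so the spread costs `6/50` of `W * l`; with the `1/10` above this is well
  -- below one half.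
  have h4 : 2 * β * s ≤ W * l * (3 / 25) := by
    have : β * (20 * s) ≤ β * l := mul_le_mul_of_nonneg_left hsl hB0
    have : β * l ≤ 6 / 5 * W * l := mul_le_mul_of_nonneg_right (by linarith) hl
    linarith
  linarith

/-- If the weighted second moment is small, then the mean `m` of the points of `B` is close to the
weighted mean `0`. -/
theorem IsSafeWeight.sq_mean_le (hc : IsSafeWeight B c)
    (hB : 12 * (Bᶜ.card : ℝ) ≤ Fintype.card ι) (hι : 0 < Fintype.card ι)
    {y : ι → ℝ} {m s : ℝ} (hy : ∑ j, c j * y j = 0) (hm : ∑ j ∈ B, (y j - m) = 0)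
    (hs : ∑ j ∈ B, (y j - m) ^ 2 ≤ 2 * B.card * s) (hs0 : 0 ≤ s)
    (hyl : ∑ j, c j * y j ^ 2 ≤ (∑ j, c j) * (20 * s)) :
    m ^ 2 ≤ 64 * s * (Bᶜ.card / Fintype.card ι) := by
  have hp : (0 : ℝ) < Fintype.card ι := by exact_mod_cast hι
  have hW := hc.le_sum hB
  have hWp : ∑ j, c j ≤ (Fintype.card ι : ℝ) := by
    simpa using Finset.sum_le_sum fun j (_ : j ∈ Finset.univ) => hc.le_one j
  have hz := hc.sq_sum_mul_le hy
  have hu : (∑ j ∈ B, (1 - c j) * (y j - m)) ^ 2 ≤ Bᶜ.card * (2 * B.card * s) := by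
    refine (Finset.sum_mul_sq_le_sq_mul_sq _ _ _).trans (mul_le_mul ?_ hs
      (Finset.sum_nonneg fun _ _ => sq_nonneg _) (Nat.cast_nonneg _))
    refine (Finset.sum_le_sum fun j _ => ?_).trans hc.removed_le_card
    nlinarith [hc.nonneg j, hc.le_one j]
  -- As the deviations from `m` sum to zero over `B`, weighting them by `c` or by `c - 1` gives the
  -- same sum.
  have hexp : (∑ j ∈ B, c j) * m
      = ∑ j ∈ B, c j * y j + ∑ j ∈ B, (1 - c j) * (y j - m) := by
    have : ∑ j ∈ B, (1 - c j) * (y j - m)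
        = ∑ j ∈ B, (y j - m) - ∑ j ∈ B, c j * y j + (∑ j ∈ B, c j) * m := by
      rw [Finset.sum_mul, ← Finset.sum_sub_distrib, ← Finset.sum_add_distrib]
      exact Finset.sum_congr rfl fun j _ => by ring
    rw [this, hm]
    ring
  have hBp := card_add_card_compl_real B
  have hb : (0 : ℝ) ≤ Bᶜ.card := Nat.cast_nonneg _
  generalize ∑ j ∈ B, (1 - c j) * (y j - m) = u at *
  generalize ∑ j ∈ B, c j * y j = z at *
  generalize ∑ j, c j * y j ^ 2 = V at *
  generalize ∑ j ∈ B, c j = w at *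
  generalize ∑ j, c j = W at *
  generalize (B.card : ℝ) = β at *
  generalize (Bᶜ.card : ℝ) = b at *
  generalize (Fintype.card ι : ℝ) = p at *
  have hbs : 0 ≤ b * s := mul_nonneg hb hs0
  have h1 : z ^ 2 ≤ 20 * p * (b * s) := by
    have : V ≤ p * (20 * s) := hyl.trans (mul_le_mul_of_nonneg_right hWp (by linarith))
    have := mul_le_mul_of_nonneg_left this hb
    linarith
  have h2 : u ^ 2 ≤ 2 * p * (b * s) := by
    have : β * (b * s) ≤ p * (b * s) := mul_le_mul_of_nonneg_right (by linarith) hbs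
    linarith
  -- `(z + u)² ≤ 2z² + 2u²` gives `44 = 2 * (20 + 2)`; dividing by `(5/6)²` then gives `63.36 ≤ 64`.
  have h3 : (w * m) ^ 2 ≤ 44 * p * (b * s) := by
    rw [hexp]
    nlinarith [sq_nonneg (z - u)]
  have h4 : (5 / 6 * p) ^ 2 * m ^ 2 ≤ 44 * p * (b * s) := by
    rw [mul_pow] at h3
    exact (mul_le_mul_of_nonneg_right (pow_le_pow_left₀ (by positivity) hW 2)
      (sq_nonneg m)).trans h3
  have h5 : p * m ^ 2 ≤ 64 * (b * s) := by
    have : p * (p * m ^ 2) ≤ p * (64 * (b * s)) := by nlinarith [mul_nonneg hp.le hbs]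
    exact le_of_mul_le_mul_left this hp
  rw [← mul_div_assoc, le_div_iff₀ hp]
  linarith

/-- Multiplying the weights by `1 - τ j / M` keeps them safe if the points of `B` contribute at
most half of the weighted sum of the scores `τ`. -/
theorem IsSafeWeight.downweight (hc : IsSafeWeight B c) {τ : ι → ℝ} {M : ℝ} (hM : 0 ≤ M)
    (hτ : ∀ j, 0 ≤ τ j) (hτM : ∀ j, c j ≠ 0 → τ j ≤ M)
    (h : ∑ j ∈ B, c j * τ j ≤ (∑ j, c j * τ j) / 2) :
    IsSafeWeight B fun j => c j * (1 - τ j / M) := by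
  refine ⟨fun j => ?_, fun j => ?_, ?_⟩
  -- A point of weight zero may have a score above `M`, but its weight stays zero.
  · rcases eq_or_ne (c j) 0 with h0 | h0
    · simp [h0]
    · exact mul_nonneg (hc.nonneg j) (sub_nonneg.2 (div_le_one_of_le₀ (hτM j h0) hM))
  · have : 0 ≤ τ j / M := div_nonneg (hτ j) hM
    nlinarith [hc.nonneg j, hc.le_one j]
  · have key (A : Finset ι) : ∑ j ∈ A, (1 - c j * (1 - τ j / M))
        = ∑ j ∈ A, (1 - c j) + (∑ j ∈ A, c j * τ j) / M := by
      rw [Finset.sum_div, ← Finset.sum_add_distrib]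
      exact Finset.sum_congr rfl fun j _ => by ring
    rw [key, key]
    refine add_le_add hc.removed_le (div_le_div_of_nonneg_right ?_ hM)
    rw [← Finset.sum_add_sum_compl B] at h
    linarith

end Weights

/-! ### Top eigenvectors -/

/-- By compactness some unit `v` attains `‖A‖`. Symmetry gives `A²v = ‖A‖²v`, so `(A - ‖A‖)(A +
‖A‖)v = 0` and `w = Av + ‖A‖v` is an eigenvector; positivity excludes `w = 0`. -/
theorem exists_isTopEigenvector {d : ℕ} {A : Vec d →L[ℝ] Vec d}
    (hA : (A : Vec d →ₗ[ℝ] Vec d).IsSymmetric) (hpos : ∀ v, 0 ≤ inner ℝ v (A v)) (h0 : 0 < ‖A‖) :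
    ∃ v, IsTopEigenvector A v := by
  obtain ⟨x, hx⟩ : ∃ x, A x ≠ 0 := by
    by_contra! h
    exact h0.ne' (norm_eq_zero.2 (ContinuousLinearMap.ext h))
  have hx0 : x ≠ 0 := fun h => hx (by simp [h])
  have hne : (Metric.sphere (0 : Vec d) 1).Nonempty :=
    ⟨(‖x‖⁻¹ : ℝ) • x, by simp [norm_smul, hx0]⟩
  obtain ⟨v, hv, hmax⟩ := (isCompact_sphere (0 : Vec d) 1).exists_isMaxOn hne
    (f := fun v => ‖A v‖) (by fun_prop)
  have hv1 : ‖v‖ = 1 := by simpa using hv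
  have hAv : ‖A v‖ = ‖A‖ := by
    refine le_antisymm (by simpa [hv1] using A.le_opNorm v)
      (A.opNorm_le_bound (norm_nonneg _) fun z => ?_)
    rcases eq_or_ne z 0 with rfl | hz
    · simp
    have hz' : 0 < ‖z‖ := norm_pos_iff.2 hz
    have : ‖A ((‖z‖⁻¹ : ℝ) • z)‖ ≤ ‖A v‖ := hmax (by simp [norm_smul, hz])
    rw [map_smul, norm_smul, norm_inv, norm_norm, inv_mul_le_iff₀ hz'] at this
    linarith
  have hsym (y z : Vec d) : inner ℝ (A y) z = inner ℝ y (A z) := hA y z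
  -- The squared norm of the difference is `‖A²v‖² - 2‖A‖²‖Av‖² + ‖A‖⁴ ≤ 0`.
  have hAA : A (A v) = (‖A‖ ^ 2) • v := by
    rw [← sub_eq_zero, ← norm_eq_zero, ← sq_eq_zero_iff]
    refine le_antisymm ?_ (sq_nonneg _)
    rw [norm_sub_sq_real, inner_smul_right, hsym, real_inner_self_eq_norm_sq, hAv, norm_smul, hv1]
    have := A.le_opNorm (A v)
    rw [hAv] at this
    have := pow_le_pow_left₀ (norm_nonneg _) this 2
    simp only [norm_pow, norm_norm]
    linarith
  set w := A v + ‖A‖ • v with hw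
  have hAw : A w = ‖A‖ • w := by
    rw [hw, map_add, map_smul, hAA, smul_add, smul_smul, sq, add_comm]
  have hw0 : w ≠ 0 := by
    intro h
    have : inner ℝ v w = inner ℝ v (A v) + ‖A‖ := by
      rw [hw, inner_add_right, inner_smul_right, real_inner_self_eq_norm_sq, hv1]
      ring
    rw [h, inner_zero_right] at this
    linarith [hpos v]
  refine ⟨(‖w‖⁻¹ : ℝ) • w, by simp [norm_smul, hw0], ?_⟩
  rw [map_smul, hAw, smul_comm]

/-! ### Statistics of data sets -/

section Statistics

variable {ι : Type*} {d : ℕ}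

theorem inner_dataCov (s : Finset ι) (x : ι → Vec d) (v : Vec d) :
    inner ℝ v (dataCov s x v)
      = (s.card : ℝ)⁻¹ * ∑ j ∈ s, (inner ℝ v (x j - dataMean s x)) ^ 2 := by
  simp only [dataCov, smul_apply, sum_apply,
    InnerProductSpace.rankOne_apply, inner_smul_right, inner_sum]
  congr 1
  refine Finset.sum_congr rfl fun j _ => ?_
  rw [real_inner_comm v, sq]

theorem sum_inner_sub_dataMean_sq_le {s : Finset ι} (hs : s.Nonempty) {x : ι → Vec d} {a : ℝ}
    (h : ‖dataCov s x‖ ≤ a) (v : Vec d) :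
    ∑ j ∈ s, (inner ℝ v (x j - dataMean s x)) ^ 2 ≤ s.card * a * ‖v‖ ^ 2 := by
  have h0 : (0 : ℝ) < s.card := by exact_mod_cast hs.card_pos
  have h1 : inner ℝ v (dataCov s x v) ≤ a * ‖v‖ ^ 2 := by
    refine (real_inner_le_norm _ _).trans ?_
    have := (dataCov s x).le_of_opNorm_le h v
    nlinarith [mul_le_mul_of_nonneg_left this (norm_nonneg v)]
  rw [inner_dataCov, inv_mul_le_iff₀ h0] at h1
  linarith

theorem sum_sub_dataMean {s : Finset ι} (hs : s.Nonempty) (x : ι → Vec d) :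
    ∑ j ∈ s, (x j - dataMean s x) = 0 := by
  have h0 : (s.card : ℝ) ≠ 0 := by exact_mod_cast hs.card_ne_zero
  rw [Finset.sum_sub_distrib, Finset.sum_const, dataMean, ← Nat.cast_smul_eq_nsmul ℝ,
    smul_inv_smul₀ h0, sub_self]

/-- The mean minimizes the sum of squared deviations in every direction. -/
theorem sum_inner_sub_dataMean_sq_le_sum {s : Finset ι} (hs : s.Nonempty) (x : ι → Vec d)
    (m v : Vec d) :
    ∑ j ∈ s, (inner ℝ v (x j - dataMean s x)) ^ 2 ≤ ∑ j ∈ s, (inner ℝ v (x j - m)) ^ 2 := by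
  have h1 : ∑ j ∈ s, inner ℝ v (x j - dataMean s x) = 0 := by
    rw [← inner_sum, sum_sub_dataMean hs, inner_zero_right]
  have h2 : ∑ j ∈ s, (inner ℝ v (x j - m)) ^ 2 = ∑ j ∈ s, (inner ℝ v (x j - dataMean s x)) ^ 2
      + 2 * inner ℝ v (dataMean s x - m) * ∑ j ∈ s, inner ℝ v (x j - dataMean s x)
      + ∑ _j ∈ s, (inner ℝ v (dataMean s x - m)) ^ 2 := by
    rw [Finset.mul_sum, ← Finset.sum_add_distrib, ← Finset.sum_add_distrib]
    refine Finset.sum_congr rfl fun j _ => ?_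
    rw [← sub_add_sub_cancel (x j) (dataMean s x) m, inner_add_right]
    ring
  rw [h2, h1, mul_zero, add_zero]
  exact le_add_of_nonneg_right (Finset.sum_nonneg fun _ _ => sq_nonneg _)

variable [Fintype ι]

theorem inner_weightedCov (c : ι → ℝ) (x : ι → Vec d) (v : Vec d) :
    inner ℝ v (weightedCov c x v) = (∑ j, c j)⁻¹ * ∑ j, c j * filterScore c x v j := by
  simp only [weightedCov, smul_apply, sum_apply,
    InnerProductSpace.rankOne_apply, inner_smul_right, inner_sum]
  congr 1
  refine Finset.sum_congr rfl fun j _ => ?_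
  rw [real_inner_comm v, filterScore, sq]

theorem isSymmetric_weightedCov (c : ι → ℝ) (x : ι → Vec d) :
    (weightedCov c x : Vec d →ₗ[ℝ] Vec d).IsSymmetric := by
  intro y z
  simp only [ContinuousLinearMap.coe_coe, weightedCov, smul_apply,
    sum_apply, InnerProductSpace.rankOne_apply, inner_smul_right, inner_sum,
    inner_smul_left, sum_inner, conj_trivial]
  congr 1
  refine Finset.sum_congr rfl fun j _ => ?_
  rw [real_inner_comm y]
  ring

theorem filterScore_nonneg (c : ι → ℝ) (x : ι → Vec d) (v : Vec d) (j : ι) :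
    0 ≤ filterScore c x v j := sq_nonneg _

theorem sum_weight_mul_inner (c : ι → ℝ) (hc : ∑ j, c j ≠ 0) (x : ι → Vec d) (v : Vec d) :
    ∑ j, c j * inner ℝ v (x j - weightedMean c x) = 0 := by
  have : ∑ j, c j • (x j - weightedMean c x) = 0 := by
    simp only [smul_sub, Finset.sum_sub_distrib, ← Finset.sum_smul]
    rw [weightedMean, smul_inv_smul₀ hc, sub_self]
  rw [← inner_zero_right v, ← this, inner_sum]
  exact Finset.sum_congr rfl fun j _ => (inner_smul_right _ _ _).symm

end Statistics

/-! ### Runs of the filter -/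

section Filter

variable {ι : Type*} [Fintype ι] {d : ℕ} {η σ : ℝ} {x : ι → Vec d}

theorem FilterReaches.nonneg {k : ℕ} {c : ι → ℝ} (h : FilterReaches η σ x k c) (j : ι) :
    0 ≤ c j := by
  induction h generalizing j with
  | init => exact zero_le_one
  | @step k c v M hc hlarge hv hM ih =>
    rcases eq_or_ne (c j) 0 with h0 | h0
    · simp [h0]
    · have hjM : filterScore c x v j ≤ M := hM.2 ⟨j, h0, rfl⟩
      exact mul_nonneg (ih j) (sub_nonneg.2
        (div_le_one_of_le₀ hjM ((filterScore_nonneg c x v j).trans hjM)))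

theorem sum_weight_mul_filterScore {c : ι → ℝ} (hc : ∑ j, c j ≠ 0) {v : Vec d}
    (hv : IsTopEigenvector (weightedCov c x) v) :
    ∑ j, c j * filterScore c x v j = (∑ j, c j) * ‖weightedCov c x‖ := by
  have h := inner_weightedCov c x v
  rw [hv.2, inner_smul_right, real_inner_self_eq_norm_sq, hv.1] at h
  field_simp at h
  linarith

/-- For total weight zero the normalizing inverse is `0` by convention, and the covariance vanishes.
-/
theorem sum_weight_ne_zero {c : ι → ℝ} (h : 0 < ‖weightedCov c x‖) : ∑ j, c j ≠ 0 := by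
  intro h0
  simp [weightedCov, h0] at h

/-- The largest score among the points of nonzero weight is positive. -/
theorem IsTopEigenvector.score_pos {c : ι → ℝ} {v : Vec d} {M : ℝ}
    (hv : IsTopEigenvector (weightedCov c x) v) (h0 : 0 < ‖weightedCov c x‖)
    (hM : IsGreatest (filterScore c x v '' {i | c i ≠ 0}) M) : 0 < M := by
  obtain ⟨i, _, hi⟩ := hM.1
  refine lt_of_le_of_ne (hi ▸ filterScore_nonneg c x v i) fun hM0 => ?_
  have h := sum_weight_mul_filterScore (sum_weight_ne_zero h0) hv
  have h1 : ∑ j, c j * filterScore c x v j = 0 := by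
    refine Finset.sum_eq_zero fun j _ => ?_
    rcases eq_or_ne (c j) 0 with hj | hj
    · simp [hj]
    · have : filterScore c x v j ≤ M := hM.2 ⟨j, hj, rfl⟩
      rw [le_antisymm (this.trans hM0.symm.le) (filterScore_nonneg c x v j), mul_zero]
  rw [h1] at h
  exact mul_ne_zero (sum_weight_ne_zero h0) h0.ne' h.symm

/-- A point attaining `M` had nonzero weight and gets the factor `1 - M / M = 0`, while old zeros
persist. `M > 0` matters, since `0 / 0 = 0` would leave the weight unchanged. -/
theorem FilterReaches.le_card_zero (hη : 0 ≤ η) {k : ℕ} {c : ι → ℝ}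
    (h : FilterReaches η σ x k c) : k ≤ (Finset.univ.filter fun j => c j = 0).card := by
  induction h with
  | init => exact Nat.zero_le _
  | @step k c v M hc hlarge hv hM ih =>
    have h0 : 0 < ‖weightedCov c x‖ := (mul_nonneg hη (sq_nonneg σ)).trans_lt hlarge
    have hM0 := hv.score_pos h0 hM
    obtain ⟨i, hi, hiM⟩ := hM.1
    refine Nat.succ_le_of_lt (ih.trans_lt (Finset.card_lt_card ?_))
    rw [Finset.ssubset_iff_of_subset fun j hj => by
      simp only [Finset.mem_filter, Finset.mem_univ, true_and] at hj ⊢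
      simp [hj]]
    refine ⟨i, ?_, by simpa using hi⟩
    simp [hiM, hM0.ne']

theorem FilterReaches.le_card (hη : 0 ≤ η) {k : ℕ} {c : ι → ℝ}
    (h : FilterReaches η σ x k c) : k ≤ Fintype.card ι :=
  (h.le_card_zero hη).trans (Finset.card_le_univ _)

/-- A run that has not stopped can be continued. -/
theorem FilterReaches.exists_step (hη : 0 ≤ η) {k : ℕ} {c : ι → ℝ}
    (h : FilterReaches η σ x k c) (hlarge : η * σ ^ 2 < ‖weightedCov c x‖) :
    ∃ c', FilterReaches η σ x (k + 1) c' := by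
  have h0 : 0 < ‖weightedCov c x‖ := (mul_nonneg hη (sq_nonneg σ)).trans_lt hlarge
  obtain ⟨v, hv⟩ := exists_isTopEigenvector (isSymmetric_weightedCov c x) (fun v => by
    rw [inner_weightedCov]
    exact mul_nonneg (inv_nonneg.2 (Finset.sum_nonneg fun j _ => h.nonneg j))
      (Finset.sum_nonneg fun j _ => mul_nonneg (h.nonneg j) (filterScore_nonneg c x v j))) h0
  obtain ⟨j, hj⟩ : ∃ j, c j ≠ 0 := by
    by_contra! hall
    exact sum_weight_ne_zero h0 (Finset.sum_eq_zero fun j _ => hall j)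
  obtain ⟨i, hi, hmax⟩ := Set.exists_max_image {i | c i ≠ 0} (filterScore c x v)
    (Set.toFinite _) ⟨j, hj⟩
  refine ⟨_, .step (M := filterScore c x v i) h hlarge hv ⟨⟨i, hi, rfl⟩, ?_⟩⟩
  rintro _ ⟨l, hl, rfl⟩
  exact hmax l hl

theorem exists_isFilterOutput (hη : 0 ≤ η) (σ : ℝ) (x : ι → Vec d) :
    ∃ g, IsFilterOutput η σ x g := by
  by_contra! hno
  have hrun (k : ℕ) : ∃ c, FilterReaches η σ x k c := by
    induction k with
    | zero => exact ⟨_, .init⟩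
    | succ k ih =>
      obtain ⟨c, hc⟩ := ih
      refine hc.exists_step hη (lt_of_not_ge fun hle => ?_)
      exact hno _ ⟨k, c, hc, hle, rfl⟩
  obtain ⟨c, hc⟩ := hrun (Fintype.card ι + 1)
  exact absurd (hc.le_card hη) (by omega)

variable [DecidableEq ι] {B : Finset ι} {m : Vec d}

/-- The centre `m` is arbitrary here. Along the unit eigenvector the claim concerns only the real
numbers `⟨v, x j - weightedMean c x⟩`. -/
theorem FilterReaches.isSafeWeight (hB : 12 * (Bᶜ.card : ℝ) ≤ Fintype.card ι)
    (hι : 0 < Fintype.card ι)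
    (hcov : ∀ v, ∑ j ∈ B, (inner ℝ v (x j - m)) ^ 2 ≤ 2 * B.card * σ ^ 2 * ‖v‖ ^ 2)
    {k : ℕ} {c : ι → ℝ} (h : FilterReaches 20 σ x k c) : IsSafeWeight B c := by
  induction h with
  | init => exact isSafeWeight_one B
  | @step k c v M hc hlarge hv hM ih =>
    have h0 : 0 < ‖weightedCov c x‖ := (by positivity : (0 : ℝ) ≤ 20 * σ ^ 2).trans_lt hlarge
    have hW := sum_weight_ne_zero h0
    refine ih.downweight (hv.score_pos h0 hM).le (filterScore_nonneg c x v)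
      (fun j hj => hM.2 ⟨j, hj, rfl⟩) ?_
    have hsum := sum_weight_mul_filterScore hW hv
    rw [hsum]
    refine ih.sum_mul_sq_le hB hι (m := inner ℝ v (m - weightedMean c x)) (s := σ ^ 2)
      (sum_weight_mul_inner c hW x v) ?_ hlarge.le h0.le hsum
    have := hcov v
    rw [hv.1] at this
    simpa [← inner_sub_right] using this

/-- Every output of the filter is close to the mean of the points of `B` if their covariance is
bounded and all but a small fraction of the points belong to `B`. -/
theorem IsFilterOutput.norm_sub_dataMean_le (hσ : 0 ≤ σ)
    (hB : 12 * (Bᶜ.card : ℝ) ≤ Fintype.card ι) (hBne : B.Nonempty)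
    (hcov : ∀ v, ∑ j ∈ B, (inner ℝ v (x j - dataMean B x)) ^ 2
      ≤ 2 * B.card * σ ^ 2 * ‖v‖ ^ 2)
    {g : Vec d} (hg : IsFilterOutput 20 σ x g) :
    ‖g - dataMean B x‖ ≤ 8 * σ * √(Bᶜ.card / Fintype.card ι) := by
  obtain ⟨k, c, hc, hsmall, rfl⟩ := hg
  have hι : 0 < Fintype.card ι := hBne.card_pos.trans_le (Finset.card_le_univ B)
  have hsafe := hc.isSafeWeight hB hι hcov
  have hWB : ∑ j ∈ B, c j ≤ ∑ j, c j :=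
    Finset.sum_le_sum_of_subset_of_nonneg (Finset.subset_univ _) fun j _ _ => hc.nonneg j
  have hW : 0 < ∑ j, c j := by
    have h1 := hsafe.le_sum hB
    have h2 : (0 : ℝ) < Fintype.card ι := by exact_mod_cast hι
    linarith
  set u := dataMean B x - weightedMean c x with hu
  rw [norm_sub_rev, ← hu]
  rcases eq_or_ne u 0 with h0 | h0
  · rw [h0, norm_zero]
    positivity
  -- In the direction of the error itself, the one-dimensional bound controls the whole norm, with
  -- no dependence on `d`.
  set v : Vec d := (‖u‖⁻¹ : ℝ) • u with hv
  have hv1 : ‖v‖ = 1 := by simp [hv, norm_smul, h0]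
  have hvu : inner ℝ v u = ‖u‖ := by
    rw [hv, real_inner_smul_left, real_inner_self_eq_norm_sq, sq,
      inv_mul_cancel_left₀ (norm_ne_zero_iff.2 h0)]
  have hsub (j : ι) : inner ℝ v (x j - weightedMean c x) - ‖u‖ = inner ℝ v (x j - dataMean B x) := by
    rw [← hvu, ← inner_sub_right, hu, sub_sub_sub_cancel_right]
  have hmain := hsafe.sq_mean_le hB hι (y := fun j => inner ℝ v (x j - weightedMean c x))
    (m := ‖u‖) (s := σ ^ 2) (sum_weight_mul_inner c hW.ne' x v) (by
      simp only [hsub]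
      rw [← inner_sum, sum_sub_dataMean hBne, inner_zero_right]) (by
      simp only [hsub]
      simpa [hv1] using hcov v) (sq_nonneg _) (by
      have h1 : inner ℝ v (weightedCov c x v) ≤ 20 * σ ^ 2 := by
        refine (real_inner_le_norm _ _).trans ?_
        simpa [hv1] using (weightedCov c x).le_of_opNorm_le hsmall v
      rwa [inner_weightedCov, inv_mul_le_iff₀ hW] at h1)
  refine le_of_sq_le_sq ?_ (by positivity)
  rw [mul_pow, mul_pow, Real.sq_sqrt (by positivity)]
  linarith

end Filter

/-! ### Shards -/

section Shards

variable {n p d : ℕ}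

theorem Sharding.mem_members {S : Sharding n p} {i : Fin n} {j : Fin p} :
    i ∈ S.members j ↔ S.shardOf i = j := by
  simp [Sharding.members]

/-- The masks cancel in a benign shard. -/
theorem Round.shardAggregate_eq_shardUpdate {r : Round n d} {S : Sharding n p}
    {K : Finset (Fin n)} (hr : r.CorruptedWithin S K) {j : Fin p} (hj : j ∈ S.benign K) :
    r.shardAggregate S j = r.shardUpdate S j := by
  have hmsg : ∀ i ∈ S.members j, r.message i = r.localUpdate i
      + ∑ k ∈ (S.members j).erase i, r.mask i k - ∑ k ∈ (S.members j).erase i, r.mask k i := by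
    intro i hi
    rw [Sharding.mem_members] at hi
    have hiK : i ∉ K := fun hK => by
      rw [Sharding.benign, Finset.mem_compl] at hj
      exact hj (hi ▸ Finset.mem_image_of_mem _ hK)
    rw [hr i hiK, Round.blindedUpdate, Sharding.peers, hi]
  -- The sent and the received masks omit the same diagonal term `mask i i`, so both sums can be
  -- completed to the whole shard; the two double sums then agree.
  have herase (f : Fin n → Vec d) (i : Fin n) (hi : i ∈ S.members j) :
      ∑ k ∈ (S.members j).erase i, f k = ∑ k ∈ S.members j, f k - f i :=
    Finset.sum_erase_eq_sub hi
  rw [Round.shardAggregate, Round.shardUpdate, dataMean, dataMean]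
  congr 1
  have hsum : ∑ i ∈ S.members j, r.message i = ∑ i ∈ S.members j, (r.localUpdate i
      + (∑ k ∈ S.members j, r.mask i k - ∑ k ∈ S.members j, r.mask k i)) := by
    refine Finset.sum_congr rfl fun i hi => ?_
    rw [hmsg i hi, herase _ i hi, herase (fun k => r.mask k i) i hi]
    abel
  rw [hsum, Finset.sum_add_distrib, Finset.sum_sub_distrib,
    Finset.sum_comm (f := fun i k => r.mask k i), sub_self, add_zero]

theorem Sharding.card_corrupted_le (S : Sharding n p) (K : Finset (Fin n)) :
    (S.corrupted K).card ≤ K.card := Finset.card_image_le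

theorem Sharding.compl_benign (S : Sharding n p) (K : Finset (Fin n)) :
    (S.benign K)ᶜ = S.corrupted K := compl_compl _

theorem Sharding.card_benign_add (S : Sharding n p) (K : Finset (Fin n)) :
    (S.benign K).card + (S.corrupted K).card = p := by
  rw [Sharding.benign, Finset.card_compl_add_card, Fintype.card_fin]

theorem Round.EstimatesWithin.mono {r : Round n d} {S : Sharding n p} {σ e e' : ℝ} {μ μ' : Vec d}
    (h : r.EstimatesWithin S σ μ e) (he : e + ‖μ - μ'‖ ≤ e') : r.EstimatesWithin S σ μ' e' :=
  ⟨h.1, h.2.1, fun g hg => by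
    have h1 := norm_sub_le_norm_sub_add_norm_sub g μ μ'
    have h2 := h.2.2 g hg
    linarith⟩

/-- The protocol estimates the mean of the benign shard updates if their covariance is bounded. -/
theorem Round.estimatesWithin_dataMean {r : Round n d} {S : Sharding n p} {K : Finset (Fin n)}
    {σ : ℝ} (hσ : 0 ≤ σ) (hr : r.CorruptedWithin S K) (hK : 12 * ((S.corrupted K).card : ℝ) < p)
    (hcov : ∀ v, ∑ j ∈ S.benign K,
      (inner ℝ v (r.shardUpdate S j - dataMean (S.benign K) (r.shardUpdate S))) ^ 2
        ≤ 2 * (S.benign K).card * σ ^ 2 * ‖v‖ ^ 2) :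
    r.EstimatesWithin S σ (dataMean (S.benign K) (r.shardUpdate S))
      (8 * σ * √(S.corruptedFraction K)) := by
  refine ⟨fun k c hc => by simpa using hc.le_card (by norm_num),
    exists_isFilterOutput (by norm_num) σ _, fun g hg => ?_⟩
  have hag : ∀ j ∈ S.benign K, r.shardAggregate S j = r.shardUpdate S j :=
    fun j hj => shardAggregate_eq_shardUpdate hr hj
  have hmean : dataMean (S.benign K) (r.shardUpdate S)
      = dataMean (S.benign K) (r.shardAggregate S) := by
    rw [dataMean, dataMean, Finset.sum_congr rfl hag]
  have hne : (S.benign K).Nonempty := by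
    rw [← Finset.card_pos]
    have h1 := S.card_benign_add K
    have h2 : 12 * (S.corrupted K).card < p := by exact_mod_cast hK
    omega
  rw [hmean]
  have := IsFilterOutput.norm_sub_dataMean_le (B := S.benign K) hσ
    (by rw [S.compl_benign, Fintype.card_fin]; exact hK.le) hne (fun v => by
      rw [← hmean]
      refine le_trans (le_of_eq (Finset.sum_congr rfl fun j hj => ?_)) (hcov v)
      rw [hag j hj]) hg
  rwa [S.compl_benign, Fintype.card_fin] at this

end Shards

/-! ### Samples of a distribution -/

section Sampling

open Filter Topology

/-- The weak law of large numbers, with a bound that depends on the distribution only. -/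
theorem exists_measure_pi_average_le {X E : Type*} [MeasurableSpace X] [NormedAddCommGroup E]
    [NormedSpace ℝ E] [CompleteSpace E] [MeasurableSpace E] [BorelSpace E]
    [SecondCountableTopology E] (D : Measure X) [IsProbabilityMeasure D] {f : X → E}
    (hf : Measurable f) (hint : Integrable f D) {t δ : ℝ} (ht : 0 < t) (hδ : 0 < δ) :
    ∃ N : ℕ, ∀ m ≥ N, Measure.pi (fun _ : Fin m => D)
      {x | t ≤ ‖(m : ℝ)⁻¹ • ∑ i, f (x i) - ∫ z, f z ∂D‖} ≤ ENNReal.ofReal δ := by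
  -- Samples of all sizes live on one infinite product, where the strong law yields convergence in
  -- measure; thus `N` is chosen before any concrete probability space.
  set μ : Measure (ℕ → X) := Measure.infinitePi fun _ => D with hμ
  have heval (i : ℕ) : μ.map (fun ω => ω i) = D := Measure.infinitePi_map_eval (fun _ => D) i
  have hid (i : ℕ) : IdentDistrib (fun ω : ℕ → X => f (ω i)) (fun ω => f (ω 0)) μ μ := by
    refine IdentDistrib.comp (u := f) ⟨(measurable_pi_apply i).aemeasurable,
      (measurable_pi_apply 0).aemeasurable, ?_⟩ hf
    rw [heval, heval]
  have hmean : ∫ ω : ℕ → X, f (ω 0) ∂μ = ∫ z, f z ∂D := by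
    conv_rhs => rw [← heval 0]
    rw [integral_map (measurable_pi_apply 0).aemeasurable hf.aestronglyMeasurable]
  have hint0 : Integrable (fun ω : ℕ → X => f (ω 0)) μ := by
    rw [← heval 0] at hint
    exact hint.comp_measurable (measurable_pi_apply 0)
  have hind : iIndepFun (fun (i : ℕ) (ω : ℕ → X) => f (ω i)) μ :=
    iIndepFun_infinitePi (P := fun _ => D) (X := fun _ => f) fun _ => hf
  have hlim := strong_law_ae (fun (i : ℕ) (ω : ℕ → X) => f (ω i)) hint0
    (fun i j hij => hind.indepFun hij) hid
  rw [hmean] at hlim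
  have hmeas := tendstoInMeasure_of_tendsto_ae
    (f := fun (m : ℕ) (ω : ℕ → X) => (m : ℝ)⁻¹ • ∑ i ∈ Finset.range m, f (ω i))
    (fun m => by
      refine Measurable.aestronglyMeasurable ?_
      exact (Finset.measurable_sum _ fun i _ => hf.comp (measurable_pi_apply i)).const_smul _)
    hlim
  rw [tendstoInMeasure_iff_norm] at hmeas
  have hev := (hmeas t ht).eventually (ge_mem_nhds (ENNReal.ofReal_pos.2 hδ))
  obtain ⟨N, hN⟩ := eventually_atTop.1 hev
  refine ⟨N, fun m hm => ?_⟩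
  have hpi : Measure.pi (fun _ : Fin m => D) = μ.map (fun ω (i : Fin m) => ω i) := by
    rw [← Measure.infinitePi_eq_pi, hμ]
    exact (Measure.map_infinitePi_infinitePi_of_inj (P := fun _ : ℕ => D)
      Fin.val_injective).symm
  rw [hpi, Measure.map_apply (by fun_prop)]
  · refine le_trans (le_of_eq (congrArg μ ?_)) (hN m hm)
    ext ω
    simp only [Set.mem_preimage, Set.mem_ofPred_eq, Finset.sum_range]
  · refine measurableSet_le measurable_const (Measurable.norm (Measurable.sub_const ?_ _))
    exact (Finset.measurable_sum _ fun i _ => hf.comp (measurable_pi_apply i)).const_smul _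

variable {d : ℕ}

/-- The rank-one operator of the deviation from `m`. -/
def deviationOp (m x : Vec d) : Vec d →L[ℝ] Vec d :=
  InnerProductSpace.rankOne ℝ (x - m) (x - m)

theorem continuous_deviationOp (m : Vec d) : Continuous (deviationOp m) := by
  have h : Continuous fun x : Vec d => x - m := by fun_prop
  exact (((InnerProductSpace.rankOne ℝ).continuous.comp h).clm_apply h)

theorem inner_deviationOp (m x v : Vec d) :
    inner ℝ v (deviationOp m x v) = (inner ℝ v (x - m)) ^ 2 := by
  rw [deviationOp, InnerProductSpace.rankOne_apply, inner_smul_right, real_inner_comm v, sq]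

theorem covarianceBilin_self_le {D : Measure (Vec d)} {a : ℝ} (h : ‖covarianceBilin D‖ ≤ a) (v : Vec d) :
    covarianceBilin D v v ≤ a * ‖v‖ ^ 2 := by
  refine (le_abs_self _).trans (((covarianceBilin D).le_opNorm₂ v v).trans ?_)
  rw [mul_assoc, ← sq]
  exact mul_le_mul_of_nonneg_right h (sq_nonneg _)

variable {D : Measure (Vec d)} [IsProbabilityMeasure D]

theorem integrable_deviationOp (hD : MemLp id 2 D) (m : Vec d) :
    Integrable (deviationOp m) D := by
  have h : Integrable (fun x => ‖x - m‖ ^ 2) D := (hD.sub (memLp_const m)).integrable_norm_pow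
    two_ne_zero
  refine h.mono' (continuous_deviationOp m).measurable.aestronglyMeasurable
    (Eventually.of_forall fun x => ?_)
  rw [deviationOp, InnerProductSpace.norm_rankOne, sq]

theorem inner_integral_deviationOp (hD : MemLp id 2 D) (v : Vec d) :
    inner ℝ v ((∫ x, deviationOp (∫ z, z ∂D) x ∂D) v) = covarianceBilin D v v := by
  have hint := integrable_deviationOp hD (∫ z, z ∂D)
  rw [ContinuousLinearMap.integral_apply hint, ← integral_inner (hint.apply_continuousLinearMap v),
    covarianceBilin_apply hD]
  refine integral_congr_ae (Eventually.of_forall fun x => ?_)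
  simp only [inner_deviationOp]
  exact sq _

/-- A distribution without covariance is concentrated at its mean. -/
theorem ae_eq_mean_of_covarianceBilin_eq_zero (hD : MemLp id 2 D) (h : covarianceBilin D = 0) :
    ∀ᵐ x ∂D, x = ∫ z, z ∂D := by
  have key (v : Vec d) : ∀ᵐ x ∂D, inner ℝ v (x - ∫ z, z ∂D) = 0 := by
    have h0 : ∫ x, (inner ℝ v (x - ∫ z, z ∂D)) ^ 2 ∂D = 0 := by
      have := covarianceBilin_apply hD v v
      rw [h] at this
      simpa [sq] using this.symm
    have hint : Integrable (fun x => (inner ℝ v (x - ∫ z, z ∂D)) ^ 2) D :=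
      ((hD.sub (memLp_const _)).const_inner v).integrable_sq
    filter_upwards [(integral_eq_zero_iff_of_nonneg (fun _ => sq_nonneg _) hint).1 h0] with x hx
    simpa using hx
  filter_upwards [ae_all_iff.2 fun i => key (EuclideanSpace.basisFun (Fin d) ℝ i)] with x hx
  rw [← sub_eq_zero]
  ext i
  rw [← EuclideanSpace.basisFun_inner, hx i]
  rfl

/-- Large samples have, with high probability, a mean close to the mean of the distribution, and
a covariance not much larger than the covariance of the distribution. -/
theorem exists_measure_pi_sample_le (hD : MemLp id 2 D) {σ η δ : ℝ} (hσ : 0 ≤ σ)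
    (hcov : ‖covarianceBilin D‖ ≤ σ ^ 2) (hη : 0 < η) (hδ : 0 < δ) :
    ∃ N : ℕ, ∀ m ≥ N, Measure.pi (fun _ : Fin m => D)
      {x | ¬ (‖(m : ℝ)⁻¹ • ∑ i, x i - ∫ z, z ∂D‖ ≤ η ∧ ∀ v : Vec d,
        ∑ i, (inner ℝ v (x i - ∫ z, z ∂D)) ^ 2 ≤ 2 * m * σ ^ 2 * ‖v‖ ^ 2)}
      ≤ ENNReal.ofReal δ := by
  set μ := ∫ z, z ∂D with hμ
  -- The law of large numbers is applied below with tolerance `σ²`, which must be positive.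
  rcases hσ.eq_or_lt with rfl | hσ0
  · have h0 : covarianceBilin D = 0 := by
      refine (norm_le_zero_iff (a := covarianceBilin D)).1 ?_
      rwa [zero_pow two_ne_zero] at hcov
    refine ⟨1, fun m hm => ?_⟩
    have hae : ∀ᵐ x ∂Measure.pi (fun _ : Fin m => D), ∀ i, x i = μ :=
      ae_all_iff.2 fun i => (Measure.quasiMeasurePreserving_eval (fun _ : Fin m => D) i).ae
        (ae_eq_mean_of_covarianceBilin_eq_zero hD h0)
    refine le_trans (le_of_eq ?_) zero_le
    rw [← ae_iff]
    filter_upwards [hae] with x hx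
    have hm0 : (m : ℝ) ≠ 0 := by positivity
    refine ⟨?_, fun v => by simp [hx]⟩
    simp only [hx, Finset.sum_const, Finset.card_univ, Fintype.card_fin,
      ← Nat.cast_smul_eq_nsmul ℝ, inv_smul_smul₀ hm0]
    simpa using hη.le
  · have hid : Integrable (fun x : Vec d => x) D := hD.integrable (by norm_num)
    have hop := integrable_deviationOp hD μ
    obtain ⟨N₁, h₁⟩ := exists_measure_pi_average_le D measurable_id' hid hη (half_pos hδ)
    -- Deviations from the true mean are i.i.d., unlike those from the sample mean. Closeness `σ²`
    -- in operator norm doubles the variance bound in all directions at once.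
    obtain ⟨N₂, h₂⟩ := exists_measure_pi_average_le D (continuous_deviationOp μ).measurable hop
      (pow_pos hσ0 2) (half_pos hδ)
    refine ⟨max (max N₁ N₂) 1, fun m hm => ?_⟩
    have hm0 : (0 : ℝ) < m := by
      have : 1 ≤ m := (le_max_right _ _).trans hm
      exact_mod_cast this
    have hb := add_le_add (h₁ m (by omega)) (h₂ m (by omega))
    rw [← ENNReal.ofReal_add (by positivity) (by positivity), add_halves] at hb
    refine le_trans ((measure_mono ?_).trans (measure_union_le _ _)) hb
    intro x hx
    by_contra hnot
    simp only [Set.mem_union, Set.mem_ofPred_eq, not_or, not_le] at hnot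
    refine hx ⟨hnot.1.le, fun v => ?_⟩
    set A := ∫ z, deviationOp μ z ∂D with hA
    set T := (m : ℝ)⁻¹ • ∑ i, deviationOp μ (x i) with hT
    have hTv : inner ℝ v (T v) = (m : ℝ)⁻¹ * ∑ i, (inner ℝ v (x i - μ)) ^ 2 := by
      simp only [hT, smul_apply, sum_apply, inner_smul_right, inner_sum, inner_deviationOp]
    have hAv : inner ℝ v (A v) ≤ σ ^ 2 * ‖v‖ ^ 2 := by
      rw [hA, hμ, inner_integral_deviationOp hD]
      exact covarianceBilin_self_le hcov v
    have hdiff : inner ℝ v ((T - A) v) ≤ σ ^ 2 * ‖v‖ ^ 2 := by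
      refine (real_inner_le_norm _ _).trans ?_
      have := (T - A).le_of_opNorm_le hnot.2.le v
      nlinarith [mul_le_mul_of_nonneg_left this (norm_nonneg v)]
    rw [sub_apply, inner_sub_right, hTv] at hdiff
    have : (m : ℝ)⁻¹ * ∑ i, (inner ℝ v (x i - μ)) ^ 2 ≤ 2 * σ ^ 2 * ‖v‖ ^ 2 := by linarith
    rw [inv_mul_le_iff₀ hm0] at this
    linarith

end Sampling

/-- A family of i.i.d. variables falls into a set with at most the probability that the product
measure gives to it. -/
theorem measure_preimage_le_pi {Ω X ι : Type*} [MeasurableSpace Ω] [MeasurableSpace X] [Fintype ι]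
    {P : Measure Ω} [IsProbabilityMeasure P] {D : Measure X} {Y : ι → Ω → X}
    (hY : ∀ i, HasLaw (Y i) D P) (hind : iIndepFun Y P) (s : Set (ι → X)) :
    P {ω | (fun i => Y i ω) ∈ s} ≤ Measure.pi (fun _ : ι => D) s := by
  have hm : ∀ i, AEMeasurable (Y i) P := fun i => (hY i).aemeasurable
  have h := (iIndepFun_iff_map_fun_eq_pi_map hm).1 hind
  simp only [(hY _).map_eq] at h
  rw [← h]
  -- This inequality needs no measurability of `s`.
  exact Measure.le_map_apply (aemeasurable_pi_lambda _ hm) s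

end FedLearning

end

/-! ### Error bounds for a fixed round and for i.i.d. benign updates -/

theorem corollary2 :
    ∃ C : ℝ, 0 < C ∧
      -- every realization, in terms of the mean and covariance of the benign shard updates
      (∀ (d n p : ℕ) (ε σ : ℝ) (S : Sharding n p) (K : Finset (Fin n)) (r : Round n d),
        0 ≤ σ → (K.card : ℝ) ≤ ε * n → 12 * ε * n < p →
        r.CorruptedWithin S K →
        ‖dataCov (S.benign K) (r.shardUpdate S)‖ ≤ σ ^ 2 →
        S.corruptedFraction K ≤ ε * n / p ∧ S.corruptedFraction K < 1 / 12 ∧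
        r.EstimatesWithin S σ (dataMean (S.benign K) (r.shardUpdate S))
          (C * σ * √(S.corruptedFraction K))) ∧
      -- i.i.d. benign shard updates, in terms of the mean and covariance of their distribution
      (∀ (d : ℕ) (D : Measure (Vec d)) (σ : ℝ), IsProbabilityMeasure D →
        MemLp id 2 D → 0 ≤ σ → ‖covarianceBilin D‖ ≤ σ ^ 2 →
        ∀ η δ : ℝ, 0 < η → 0 < δ → ∃ N : ℕ,
        ∀ (n p : ℕ) (ε : ℝ) (S : Sharding n p) (K : Finset (Fin n)),
          N ≤ p → (K.card : ℝ) ≤ ε * n → 12 * ε * n < p →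
          ∀ (Ω : Type*) (_ : MeasurableSpace Ω) (P : Measure Ω) (_ : IsProbabilityMeasure P)
            (R : Ω → Round n d),
            (∀ ω, (R ω).CorruptedWithin S K) →
            (∀ j ∈ S.benign K, HasLaw (fun ω => (R ω).shardUpdate S j) D P) →
            iIndepFun (fun (j : S.benign K) ω => (R ω).shardUpdate S j) P →
            ∃ G : Set Ω, MeasurableSet G ∧ 1 - δ ≤ P.real G ∧
              ∀ ω ∈ G, (R ω).EstimatesWithin S σ (∫ x, x ∂D)
                (C * σ * √(S.corruptedFraction K) + η)) := by
  have hcorr {n p : ℕ} {ε : ℝ} (S : Sharding n p) (K : Finset (Fin n))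
      (hK : (K.card : ℝ) ≤ ε * n) : ((S.corrupted K).card : ℝ) ≤ ε * n :=
    le_trans (by exact_mod_cast S.card_corrupted_le K) hK
  refine ⟨8, by norm_num, ?_, ?_⟩
  · intro d n p ε σ S K r hσ hK hε hr hcov
    have hc := hcorr S K hK
    have hp : (0 : ℝ) < p := by
      have : (0 : ℝ) ≤ K.card := Nat.cast_nonneg _
      linarith
    have hb : 12 * ((S.corrupted K).card : ℝ) < p := by linarith
    have hne : (S.benign K).Nonempty := by
      rw [← Finset.card_pos]
      have h1 := S.card_benign_add K
      have h2 : 12 * (S.corrupted K).card < p := by exact_mod_cast hb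
      omega
    refine ⟨div_le_div_of_nonneg_right hc hp.le, ?_, ?_⟩
    · rw [Sharding.corruptedFraction, div_lt_iff₀ hp]
      linarith
    · refine Round.estimatesWithin_dataMean hσ hr hb fun v => ?_
      refine (sum_inner_sub_dataMean_sq_le hne hcov v).trans ?_
      have : (0 : ℝ) ≤ (S.benign K).card * σ ^ 2 * ‖v‖ ^ 2 := by positivity
      linarith
  · intro d D σ _ hD hσ hcov η δ hη hδ
    obtain ⟨N, hN⟩ := exists_measure_pi_sample_le hD hσ hcov hη hδ
    -- More than `11/12` of the shards are benign, so `p ≥ 2N` leaves at least `N` samples.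
    refine ⟨2 * N, fun n p ε S K hNp hK hε Ω _ P _ R hR hlaw hind => ?_⟩
    have hb : 12 * ((S.corrupted K).card : ℝ) < p := by linarith [hcorr S K hK]
    have hb' : 12 * (S.corrupted K).card < p := by exact_mod_cast hb
    have hcard := S.card_benign_add K
    have hne : (S.benign K).Nonempty := by
      rw [← Finset.card_pos]
      omega
    set B := S.benign K with hB
    set e : Fin B.card ≃ B := B.equivFin.symm with he
    have hsum {E : Type} [AddCommMonoid E] (f : Fin p → E) :
        ∑ i, f (e i) = ∑ j ∈ B, f j := by
      rw [← Finset.sum_coe_sort B f]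
      exact Equiv.sum_comp e fun j => f j
    have hbad := (measure_preimage_le_pi (Y := fun i ω => (R ω).shardUpdate S (e i))
      (fun i => hlaw _ (e i).2) (hind.precomp e.injective) _).trans (hN B.card (by omega))
    obtain ⟨s, hgood, hs⟩ : ∃ s : Set Ω, (∀ ω, ω ∉ s →
        ‖(B.card : ℝ)⁻¹ • ∑ i, (R ω).shardUpdate S (e i) - ∫ x, x ∂D‖ ≤ η ∧ ∀ v : Vec d,
          ∑ i, (inner ℝ v ((R ω).shardUpdate S (e i) - ∫ x, x ∂D)) ^ 2
            ≤ 2 * B.card * σ ^ 2 * ‖v‖ ^ 2) ∧ P s ≤ ENNReal.ofReal δ := by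
      refine ⟨_, fun ω h => ?_, hbad⟩
      simpa only [Set.mem_ofPred_eq, not_not] using h
    -- The bad event need not be measurable; its measurable hull has the same probability.
    refine ⟨(toMeasurable P s)ᶜ, (measurableSet_toMeasurable P s).compl, ?_, fun ω hω => ?_⟩
    · rw [probReal_compl_eq_one_sub (measurableSet_toMeasurable P s), measureReal_def,
        measure_toMeasurable]
      have := ENNReal.toReal_le_of_le_ofReal hδ.le hs
      linarith
    · obtain ⟨hmean, hdev⟩ := hgood ω fun h => hω (subset_toMeasurable P s h)
      rw [hsum fun j => (R ω).shardUpdate S j] at hmean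
      refine (Round.estimatesWithin_dataMean hσ (hR ω) hb fun v => ?_).mono
        (add_le_add_right hmean _)
      -- The filter bound needs deviations from the sample mean, which are dominated by those from
      -- the true mean.
      refine (sum_inner_sub_dataMean_sq_le_sum hne _ (∫ x, x ∂D) v).trans ?_
      rw [← hsum fun j => (inner ℝ v ((R ω).shardUpdate S j - ∫ x, x ∂D)) ^ 2]
      exact hdev v
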